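/- Let $X$ be a locally compact non-compact Hausdorff space. A one-point Tychonoff extension of $X$ is a Tychonoff space $Y=X\cup\{p\}$, $p\notin X$, which contains $X$ as a dense subspace. Two such extensions $Y_1,Y_2$ are identified if there is a homeomorphism $Y_1\to Y_2$ fixing $X$ pointwise, and one writes $Y_2\le Y_1$ if there is a continuous map $Y_1\to Y_2$ fixing $X$ pointwise; this is a partial order on the equivalence classes. Let $\mathcal T^*(X)$ be the partially ordered set of all (classes of) one-point Tychonoff extensions $Y=X\cup\{p\}$ of $X$ which are first countable at $p$. Let $\upsilon X$ be the Hewitt realcompactification of $X$. A space is pseudocompact if every continuous real-valued function on it is bounded, and a subset of $X$ is pseudocompact if it is so as a subspace. Subsets $A,B$ of $X$ are completely separated in $X$ if there is a continuous $f:X\to[0,1]$ with $f=0$ on $A$ and $f=1$ on $B$. (1) $\mathcal T^*(X)$ has no maximal element. (2) Consider the conditions: (a) $\mathcal T^*(X)$ has a minimal element; (b) $\mathcal T^*(X)$ has a minimum; (c) $\upsilon X$ is locally compact and $\sigma$-compact; (d) $X=\bigcup_{n<\omega}A_n$, where for each $n<\omega$ the set $A_n$ is pseudocompact, and $A_n$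 and $X\setminus A_{n+1}$ are completely separated in $X$. Then (a) and (b) are equivalent, and (c) and (d) are equivalent. If $X$ is not pseudocompact, all four conditions are equivalent. -/

import Mathlib

open Set Topology

universe u

/-- A Tychonoff extension of `X`: a Tychonoff space in which `X` is densely embedded. -/
structure TychonoffExtension (X : Type u) [TopologicalSpace X] where
  carrier : Type u
  [top : TopologicalSpace carrier]
  [t35 : T35Space carrier]
  emb : X → carrier
  isDenseEmbedding : IsDenseEmbedding emb

namespace TychonoffExtension

attribute [instance] TychonoffExtension.top TychonoffExtension.t35

variable {X : Type u} [TopologicalSpace X]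

/-- `Y₂.IsBelow Y₁`: there is a continuous map `Y₁ → Y₂` keeping `X` pointwise fixed. -/
def IsBelow (Y₂ Y₁ : TychonoffExtension X) : Prop :=
  ∃ f : Y₁.carrier → Y₂.carrier, Continuous f ∧ ∀ x, f (Y₁.emb x) = Y₂.emb x

/-- Two extensions are equivalent if there is a homeomorphism between them keeping `X`
pointwise fixed. -/
def IsEquivalent (Y₁ Y₂ : TychonoffExtension X) : Prop :=
  ∃ h : Y₁.carrier ≃ₜ Y₂.carrier, ∀ x, h (Y₁.emb x) = Y₂.emb x

theorem IsBelow.refl (Y : TychonoffExtension X) : Y.IsBelow Y :=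
  ⟨id, continuous_id, fun _ => rfl⟩

theorem IsBelow.trans {Y₁ Y₂ Y₃ : TychonoffExtension X}
    (h₁ : Y₁.IsBelow Y₂) (h₂ : Y₂.IsBelow Y₃) : Y₁.IsBelow Y₃ := by
  obtain ⟨f, hf, hfx⟩ := h₁
  obtain ⟨g, hg, hgx⟩ := h₂
  exact ⟨f ∘ g, hf.comp hg, fun x => by simp [hgx, hfx]⟩

theorem IsEquivalent.symm {Y₁ Y₂ : TychonoffExtension X}
    (h : Y₁.IsEquivalent Y₂) : Y₂.IsEquivalent Y₁ := by
  obtain ⟨e, he⟩ := h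
  exact ⟨e.symm, fun x => by rw [← he x, e.symm_apply_apply]⟩

theorem IsEquivalent.isBelow {Y₁ Y₂ : TychonoffExtension X}
    (h : Y₁.IsEquivalent Y₂) : Y₂.IsBelow Y₁ := by
  obtain ⟨e, he⟩ := h
  exact ⟨e, e.continuous, he⟩

theorem IsBelow.antisymm {Y₁ Y₂ : TychonoffExtension X}
    (h₁ : Y₁.IsBelow Y₂) (h₂ : Y₂.IsBelow Y₁) : Y₁.IsEquivalent Y₂ := by
  obtain ⟨f, hf, hfx⟩ := h₁
  obtain ⟨g, hg, hgx⟩ := h₂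
  have hfg : f ∘ g = id := Y₁.isDenseEmbedding.dense.equalizer (hf.comp hg) continuous_id
    (funext fun x => by simp [hgx, hfx])
  have hgf : g ∘ f = id := Y₂.isDenseEmbedding.dense.equalizer (hg.comp hf) continuous_id
    (funext fun x => by simp [hgx, hfx])
  exact ⟨{ toFun := g, invFun := f, left_inv := congrFun hfg, right_inv := congrFun hgf,
           continuous_toFun := hg, continuous_invFun := hf }, hgx⟩

instance setoid (X : Type u) [TopologicalSpace X] : Setoid (TychonoffExtension X) where
  r := IsEquivalent
  iseqv :=
    { refl := fun Y => ⟨Homeomorph.refl _, fun _ => rfl⟩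
      symm := IsEquivalent.symm
      trans := by
        rintro Y₁ Y₂ Y₃ ⟨e, he⟩ ⟨e', he'⟩
        exact ⟨e.trans e', fun x => by simp [he, he']⟩ }

end TychonoffExtension

/-- The equivalence classes of Tychonoff extensions of `X`. -/
def ExtensionClass (X : Type u) [TopologicalSpace X] : Type (u + 1) :=
  Quotient (TychonoffExtension.setoid X)

namespace ExtensionClass

/-- The class of an extension. -/
def mk {X : Type u} [TopologicalSpace X] (Y : TychonoffExtension X) : ExtensionClass X :=
  Quotient.mk _ Y

/-- `mk Y₂ ≤ mk Y₁` if and only if there is a continuous map `Y₁ → Y₂` keeping `X`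
pointwise fixed. -/
instance partialOrder (X : Type u) [TopologicalSpace X] : PartialOrder (ExtensionClass X) where
  le := Quotient.lift₂ TychonoffExtension.IsBelow (by
    intro Y₁ Y₂ Z₁ Z₂ h₁ h₂
    refine propext ⟨fun h => ?_, fun h => ?_⟩
    · exact (TychonoffExtension.IsEquivalent.isBelow h₁).trans
        (h.trans (TychonoffExtension.IsEquivalent.symm h₂).isBelow)
    · exact (TychonoffExtension.IsEquivalent.symm h₁).isBelow.trans
        (h.trans (TychonoffExtension.IsEquivalent.isBelow h₂)))
  le_refl := by
    rintro ⟨Y⟩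
    exact TychonoffExtension.IsBelow.refl Y
  le_trans := by
    rintro ⟨Y₁⟩ ⟨Y₂⟩ ⟨Y₃⟩ h₁ h₂
    exact TychonoffExtension.IsBelow.trans h₁ h₂
  le_antisymm := by
    rintro ⟨Y₁⟩ ⟨Y₂⟩ h₁ h₂
    exact Quotient.sound (TychonoffExtension.IsBelow.antisymm h₁ h₂)

end ExtensionClass

/-- The set `𝒯*(X)` of (classes of) one-point Tychonoff extensions `Y = X ∪ {p}` of `X` which are
first countable at `p`, that is, the neighborhood filter of `p` has a countable base. It is ordered
by the partial order of `ExtensionClass X`. -/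
def TStar (X : Type u) [TopologicalSpace X] : Set (ExtensionClass X) :=
  {c | ∃ Y : TychonoffExtension X, ExtensionClass.mk Y = c ∧
    ∃ p : Y.carrier, (range Y.emb)ᶜ = {p} ∧ (𝓝 p).IsCountablyGenerated}

/-- Every continuous real-valued function on `Y` is bounded. -/
def IsPseudocompactSpace (Y : Type u) [TopologicalSpace Y] : Prop :=
  ∀ f : C(Y, ℝ), Bornology.IsBounded (range f)

/-- `A` and `B` are completely separated in `X`: some continuous `f : X → [0, 1]` is `0` on `A`
and `1` on `B`. -/
def AreCompletelySeparated {X : Type u} [TopologicalSpace X] (A B : Set X) : Prop :=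
  ∃ f : C(X, unitInterval), (∀ x ∈ A, f x = 0) ∧ ∀ x ∈ B, f x = 1

/-- The Hewitt realcompactification `υX` of a Tychonoff space `X`: the closure of the image of `X`
under the canonical embedding `x ↦ (f x)_f` into the product `ℝ ^ C(X, ℝ)`. It is a closed subspace
of a power of `ℝ`, hence realcompact, it contains `X` as a dense subspace, and every continuous
`f : X → ℝ` extends to it (by the coordinate projection at `f`); these properties determine
it up to a homeomorphism fixing `X`. -/
abbrev HewittRealcompactification (X : Type u) [TopologicalSpace X] : Type u :=
  closure (range fun (x : X) (f : C(X, ℝ)) => f x)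

/-! A one-point extension is determined by the trace on `X` of the neighborhood filter at `p`, and a
larger extension has a finer trace (`HasTrace.le_iff`). First countability at `p` makes the traces
exactly the filters `comap g atTop`, with `g` continuous and unbounded above. So the order on
`𝒯*(X)` becomes a comparison of real functions. Any `g` can be cut down to 0 along part of a
sequence where it tends to infinity, giving a strictly finer filter: nothing is maximal. Two filters
have the common coarsening given by `g ⊔ h`, so a minimal element is a minimum. Conditions (b), (c),
(d) meet in `BoundsSublevels`: some `h` has the property that every continuous function is bounded
on each `{h < n}`. Its equivalence with (c) and (d) holds for every `X`; for (b), `h` must be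
unbounded above, which is where non-pseudocompactness enters. -/

open Filter

/-! ### Extensions as filters on `X` -/

section Trace

variable {X : Type u} [TopologicalSpace X]

/-- The class `c` contains a one-point extension of `X` whose additional point has
the trace `F` of its neighborhood filter on `X`. -/
def HasTrace (c : ExtensionClass X) (F : Filter X) : Prop :=
  ∃ Y : TychonoffExtension X, ExtensionClass.mk Y = c ∧
    ∃ p : Y.carrier, (range Y.emb)ᶜ = {p} ∧ comap Y.emb (𝓝 p) = F

theorem ExtensionClass.mk_le_mk {Y Y' : TychonoffExtension X} :
    ExtensionClass.mk Y' ≤ ExtensionClass.mk Y ↔ Y'.IsBelow Y :=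
  Iff.rfl

/-- A map fixing `X` must send `p` to `p'`: if it sent `p` to a point `x` of `X`, the trace at `p`
would converge to `x`, so `p` and `x` could not be separated in `Y`. Conversely, `F ≤ F'` is what
extension by density needs at `p`. -/
theorem HasTrace.le_iff {c c' : ExtensionClass X} {F F' : Filter X} (h : HasTrace c F)
    (h' : HasTrace c' F') : c' ≤ c ↔ F ≤ F' := by
  obtain ⟨Y, rfl, p, hp, rfl⟩ := h
  obtain ⟨Y', rfl, p', hp', rfl⟩ := h'
  have hi := Y.isDenseEmbedding.toIsDenseInducing
  have hi' := Y'.isDenseEmbedding.toIsDenseInducing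
  rw [ExtensionClass.mk_le_mk]
  constructor
  · rintro ⟨f, hf, hfx⟩
    have hfe : f ∘ Y.emb = Y'.emb := funext hfx
    have key : comap Y.emb (𝓝 p) ≤ comap Y'.emb (𝓝 (f p)) := by
      rw [← hfe, ← comap_comap]
      exact comap_mono (hf.tendsto p).le_comap
    have hfp : f p = p' := by
      by_contra hne
      have : f p ∈ range Y'.emb := by
        by_contra hmem
        have : f p ∈ (range Y'.emb)ᶜ := hmem
        rw [hp'] at this
        exact hne this
      obtain ⟨x, hx⟩ := this
      rw [← hx, ← hi'.toIsInducing.nhds_eq_comap, hi.toIsInducing.nhds_eq_comap x] at key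
      have hpx : p ≠ Y.emb x := by
        intro h
        have : p ∈ (range Y.emb)ᶜ := by rw [hp]; rfl
        exact this ⟨x, h.symm⟩
      have hdisj := (disjoint_nhds_nhds.2 hpx)
      have hnb : (comap Y.emb (𝓝 p)).NeBot := hi.comap_nhds_neBot p
      have : comap Y.emb (𝓝 p) ≤ comap Y.emb (𝓝 p ⊓ 𝓝 (Y.emb x)) := by
        rw [comap_inf]
        exact le_inf le_rfl key
      rw [hdisj.eq_bot, comap_bot] at this
      exact hnb.ne (le_bot_iff.1 this)
    rwa [hfp] at key
  · intro hle
    refine ⟨hi.extend Y'.emb, hi.continuous_extend fun b => ?_,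
      hi.extend_eq hi'.continuous⟩
    by_cases hb : b ∈ range Y.emb
    · obtain ⟨x, rfl⟩ := hb
      refine ⟨Y'.emb x, ?_⟩
      rw [← hi.toIsInducing.nhds_eq_comap]
      exact hi'.continuous.tendsto x
    · have : b = p := by
        have : b ∈ (range Y.emb)ᶜ := hb
        rwa [hp] at this
      subst this
      exact ⟨p', tendsto_iff_comap.2 hle⟩

/-- A point of a Tychonoff space with a countably generated neighborhood filter has its
neighborhood filter induced by a nonnegative real-valued continuous function. -/
theorem exists_continuous_comap_nhds_zero {Y : Type*} [TopologicalSpace Y]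
    [CompletelyRegularSpace Y] (p : Y) [(𝓝 p).IsCountablyGenerated] :
    ∃ f : Y → ℝ, Continuous f ∧ (∀ y, 0 ≤ f y) ∧ comap f (𝓝 0) = 𝓝 p := by
  obtain ⟨U, hU⟩ := (𝓝 p).exists_antitone_basis
  have hex : ∀ n, ∃ f : Y → unitInterval, Continuous f ∧ f p = 0 ∧
      EqOn f 1 (interior (U n))ᶜ := fun n =>
    CompletelyRegularSpace.completely_regular_isOpen p _ isOpen_interior
      (mem_interior_iff_mem_nhds.2 (hU.mem n))
  choose f hf hfp hf1 using hex
  have hs : Summable fun n : ℕ => (1 / 2 : ℝ) ^ n := summable_geometric_two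
  have hnn : ∀ n y, 0 ≤ (1 / 2 : ℝ) ^ n * (f n y : ℝ) := fun n y =>
    mul_nonneg (by positivity) (f n y).2.1
  have hle : ∀ n y, (1 / 2 : ℝ) ^ n * (f n y : ℝ) ≤ (1 / 2 : ℝ) ^ n := fun n y =>
    mul_le_of_le_one_right (by positivity) (f n y).2.2
  have hsum : ∀ y, Summable fun n : ℕ => (1 / 2 : ℝ) ^ n * (f n y : ℝ) := fun y =>
    Summable.of_nonneg_of_le (fun n => hnn n y) (fun n => hle n y) hs
  have hcont : Continuous fun y => ∑' n : ℕ, (1 / 2 : ℝ) ^ n * (f n y : ℝ) := by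
    refine continuous_tsum (fun n => continuous_const.mul (continuous_subtype_val.comp (hf n)))
      hs fun n y => ?_
    rw [Real.norm_of_nonneg (hnn n y)]
    exact hle n y
  refine ⟨_, hcont, fun y => tsum_nonneg fun n => hnn n y, le_antisymm ?_ ?_⟩
  · refine hU.toHasBasis.ge_iff.2 fun n _ => ?_
    refine mem_comap.2 ⟨Iio ((1 / 2 : ℝ) ^ n), Iio_mem_nhds (by positivity), fun y hy => ?_⟩
    by_contra hyU
    have h1 : f n y = 1 := hf1 n fun h => hyU (interior_subset h)
    have := (hsum y).le_tsum n fun m _ => hnn m y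
    rw [h1] at this
    simp only [mem_preimage, mem_Iio, Icc.coe_one, mul_one] at hy this
    exact absurd hy (not_lt.2 this)
  · refine tendsto_iff_comap.1 ?_
    have := hcont.tendsto p
    simpa [hfp] using this

/-- Take `g = -log f` with `f` inducing the neighborhoods of `p`; `f` is positive on `X`. -/
theorem exists_hasTrace_of_mem_TStar {c : ExtensionClass X} (hc : c ∈ TStar X) :
    ∃ g : C(X, ℝ), (comap g atTop).NeBot ∧ HasTrace c (comap g atTop) := by
  obtain ⟨Y, rfl, p, hp, hcg⟩ := hc
  obtain ⟨f, hf, hf0, hfp⟩ := exists_continuous_comap_nhds_zero p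
  have hi := Y.isDenseEmbedding.toIsDenseInducing
  have hpos : ∀ x, 0 < f (Y.emb x) := by
    intro x
    refine (hf0 _).lt_of_ne fun h => ?_
    have hpx : p ≠ Y.emb x := by
      rintro h
      have : p ∈ (range Y.emb)ᶜ := by rw [hp]; rfl
      exact this ⟨x, h.symm⟩
    have : (pure (Y.emb x) : Filter Y.carrier) ≤ 𝓝 p := by
      rw [← hfp, ← map_le_iff_le_comap, map_pure, ← h]
      exact pure_le_nhds _
    exact hpx ((pure_le_nhds_iff).1 this).symm
  let g : C(X, ℝ) := ⟨fun x => -Real.log (f (Y.emb x)),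
    ((hf.comp hi.continuous).log fun x => (hpos x).ne').neg⟩
  have hg : comap g atTop = comap Y.emb (𝓝 p) := by
    have : f ∘ Y.emb = Real.exp ∘ Neg.neg ∘ g := by
      funext x
      simp [g, Real.exp_log (hpos x)]
    rw [← hfp, comap_comap, this, ← comap_comap, Real.comap_exp_nhds_zero, ← comap_comap,
      comap_neg_atBot]
  refine ⟨g, ?_, Y, rfl, p, hp, hg.symm⟩
  rw [hg]
  exact hi.comap_nhds_neBot p

theorem comap_atTop_le_coclosedCompact (g : C(X, ℝ)) : comap g atTop ≤ coclosedCompact X := by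
  refine hasBasis_coclosedCompact.ge_iff.2 fun K hK => ?_
  obtain ⟨M, hM⟩ := (hK.2.image g.continuous).bddAbove
  refine mem_comap.2 ⟨Ioi M, Ioi_mem_atTop M, fun x hx hxK => ?_⟩
  exact not_lt.2 (hM (mem_image_of_mem g hxK)) hx

section OfUnbounded

variable [T2Space X] [LocallyCompactSpace X]

/-- The graph of `exp (-g)`, extended by `0` at the point at infinity. -/
noncomputable def expNegGraph (g : C(X, ℝ)) (z : OnePoint X) : OnePoint X × ℝ :=
  (z, z.elim 0 fun x => Real.exp (-g x))

/-- The one-point extension of `X` in which the neighborhoods of the additional point are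
determined by the sets on which `g` is large. -/
noncomputable def TychonoffExtension.ofUnbounded (g : C(X, ℝ)) (hg : (comap g atTop).NeBot) :
    TychonoffExtension X where
  carrier := range (expNegGraph g)
  emb x := ⟨expNegGraph g x, mem_range_self _⟩
  isDenseEmbedding := by
    have hcont : Continuous fun x : X => expNegGraph g x :=
      OnePoint.continuous_coe.prodMk (Real.continuous_exp.comp g.continuous.neg)
    have hemb : IsEmbedding fun x : X => (⟨expNegGraph g x, mem_range_self _⟩ :
        range (expNegGraph g)) := by
      refine IsEmbedding.of_comp (hcont.subtype_mk _)
        (continuous_fst.comp continuous_subtype_val) ?_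
      exact OnePoint.isOpenEmbedding_coe.isEmbedding
    refine ⟨⟨hemb.isInducing, ?_⟩, hemb.injective⟩
    rintro ⟨_, z, rfl⟩
    induction z using OnePoint.rec with
    | coe x => exact subset_closure (mem_range_self x)
    | infty =>
      refine mem_closure_of_tendsto (b := comap g atTop) ?_ (Eventually.of_forall mem_range_self)
      rw [tendsto_subtype_rng]
      refine Tendsto.prodMk_nhds ?_ ?_
      · exact OnePoint.tendsto_coe_infty.mono_left (comap_atTop_le_coclosedCompact g)
      · exact Real.tendsto_exp_neg_atTop_nhds_zero.comp tendsto_comap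

/-- The real coordinate alone controls the point at infinity: `g` is bounded on compact sets, so a
small `exp (-g)` forces the point out of any given one. -/
theorem TychonoffExtension.ofUnbounded_nhds (g : C(X, ℝ)) (hg : (comap g atTop).NeBot)
    (p : (ofUnbounded g hg).carrier) (hp : p.1 = expNegGraph g OnePoint.infty) :
    𝓝 p = comap (fun y : (ofUnbounded g hg).carrier => y.1.2) (𝓝 0) := by
  have h : 𝓝 p = comap (fun y : (ofUnbounded g hg).carrier => y.1.1) (𝓝 OnePoint.infty) ⊓
      comap (fun y : (ofUnbounded g hg).carrier => y.1.2) (𝓝 0) := by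
    have h1 : 𝓝 p = comap Subtype.val (𝓝 p.1) := nhds_subtype_eq_comap
    rw [h1, hp, expNegGraph, OnePoint.elim_infty, nhds_prod_eq, prod_eq_inf, comap_inf,
      comap_comap, comap_comap]
    rfl
  rw [h, inf_eq_right, ← map_le_iff_le_comap]
  change Tendsto _ _ _
  refine OnePoint.hasBasis_nhds_infty.tendsto_right_iff.2 fun K hK => ?_
  obtain ⟨M, hM⟩ := (hK.2.image g.continuous).bddAbove
  refine mem_comap.2 ⟨Iio (Real.exp (-M)), Iio_mem_nhds (Real.exp_pos _), ?_⟩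
  rintro ⟨_, z, rfl⟩ hz
  induction z using OnePoint.rec with
  | infty => exact Or.inr rfl
  | coe x =>
    refine Or.inl (mem_image_of_mem _ fun hx => ?_)
    have h1 : Real.exp (-g x) < Real.exp (-M) := hz
    have h2 := hM (mem_image_of_mem g hx)
    rw [Real.exp_lt_exp] at h1
    linarith

theorem exists_hasTrace_comap_atTop (g : C(X, ℝ)) (hg : (comap g atTop).NeBot) :
    ∃ c ∈ TStar X, HasTrace c (comap g atTop) := by
  let Y := TychonoffExtension.ofUnbounded g hg
  let p : Y.carrier := ⟨expNegGraph g OnePoint.infty, mem_range_self _⟩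
  have hp : (range Y.emb)ᶜ = {p} := by
    ext y
    obtain ⟨_, z, rfl⟩ := y
    change ¬ _ ∈ range Y.emb ↔ _ = p
    induction z using OnePoint.rec with
    | infty =>
      refine iff_of_true ?_ rfl
      rintro ⟨x, hx⟩
      exact OnePoint.coe_ne_infty x (congrArg (fun y : Y.carrier => y.1.1) hx)
    | coe x =>
      refine iff_of_false (fun h => h ⟨x, rfl⟩) fun h => ?_
      exact OnePoint.coe_ne_infty x (congrArg (fun y : Y.carrier => y.1.1) h)
  have hn := TychonoffExtension.ofUnbounded_nhds g hg p rfl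
  refine ⟨ExtensionClass.mk Y, ⟨Y, rfl, p, hp, ?_⟩, Y, rfl, p, hp, ?_⟩
  · rw [hn]
    infer_instance
  · have : (fun y : Y.carrier => y.1.2) ∘ Y.emb = Real.exp ∘ Neg.neg ∘ g := rfl
    rw [hn, comap_comap, this, ← comap_comap, Real.comap_exp_nhds_zero, ← comap_comap,
      comap_neg_atBot]

end OfUnbounded

end Trace

/-! ### Functions with bounding sublevel sets, and pseudocompact covers -/

section Proper

variable {X : Type u} [TopologicalSpace X]

/-- Every continuous real-valued function on the space is bounded on every set `{x | h x < n}`. -/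
def BoundsSublevels (h : C(X, ℝ)) : Prop :=
  ∀ (n : ℕ) (f : C(X, ℝ)), ∃ M, ∀ x, h x < n → |f x| ≤ M

theorem isPseudocompactSpace_iff :
    IsPseudocompactSpace X ↔ ∀ f : C(X, ℝ), ∃ M, ∀ x, |f x| ≤ M := by
  refine forall_congr' fun f => ?_
  rw [isBounded_iff_forall_norm_le]
  simp

theorem comap_atTop_neBot_iff {α : Type*} {g : α → ℝ} : (comap g atTop).NeBot ↔ ∀ M, ∃ x, M < g x := by
  rw [(atTop_basis_Ioi.comap g).neBot_iff]
  simp [Set.Nonempty]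

theorem comap_atTop_le_comap_atTop_iff {α : Type*} {g h : α → ℝ} :
    comap g atTop ≤ comap h atTop ↔ ∀ n, ∃ M, ∀ x, M < g x → n < h x := by
  rw [(atTop_basis_Ioi.comap g).le_basis_iff (atTop_basis_Ioi.comap h)]
  simp [subset_def]

theorem exists_boundsSublevels_iff_exists_least (hX : ¬ IsPseudocompactSpace X) :
    (∃ h : C(X, ℝ), BoundsSublevels h) ↔ ∃ h : C(X, ℝ), (comap h atTop).NeBot ∧
      ∀ g : C(X, ℝ), (comap g atTop).NeBot → comap g atTop ≤ comap h atTop := by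
  constructor
  · rintro ⟨h, hh⟩
    refine ⟨h, ?_, fun g _ => ?_⟩
    · rw [comap_atTop_neBot_iff]
      by_contra! hM
      obtain ⟨M, hM⟩ := hM
      obtain ⟨n, hn⟩ := exists_nat_gt M
      refine hX (isPseudocompactSpace_iff.2 fun f => ?_)
      obtain ⟨B, hB⟩ := hh n f
      exact ⟨B, fun x => hB x ((hM x).trans_lt hn)⟩
    · rw [comap_atTop_le_comap_atTop_iff]
      intro r
      obtain ⟨n, hn⟩ := exists_nat_gt r
      obtain ⟨M, hM⟩ := hh n g
      refine ⟨M, fun x hx => hn.trans_le ?_⟩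
      by_contra! hlt
      exact absurd ((le_abs_self _).trans (hM x hlt)) (not_le.2 hx)
  · rintro ⟨h, -, hmin⟩
    refine ⟨h, fun n f => ?_⟩
    by_contra! hf
    -- The cutoff is at least 1 where `h < n` and 0 where `h ≥ n + 1`: `g` stays unbounded but
    -- vanishes where `h` is large.
    let g : C(X, ℝ) := |f| * ((ContinuousMap.const X ((n : ℝ) + 1) - h) ⊔ 0)
    have hg : ∀ x, g x = |f x| * max ((n : ℝ) + 1 - h x) 0 := fun x => rfl
    have hgn : (comap g atTop).NeBot := by
      rw [comap_atTop_neBot_iff]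
      intro M
      obtain ⟨x, hx, hMx⟩ := hf M
      refine ⟨x, hMx.trans_le ?_⟩
      rw [hg]
      refine le_mul_of_one_le_right (abs_nonneg _) ((le_max_left _ _).trans' ?_)
      linarith
    obtain ⟨M, hM⟩ := comap_atTop_le_comap_atTop_iff.1 (hmin g hgn) (n + 1)
    obtain ⟨x, hx⟩ := comap_atTop_neBot_iff.1 hgn (max M 0)
    have h1 := hM x ((le_max_left _ _).trans_lt hx)
    have h2 := (le_max_right _ _).trans_lt hx
    rw [hg, max_eq_right (by linarith), mul_zero] at h2
    exact lt_irrefl _ h2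

/-- Sum the separating functions. Where `f m < 1` one is inside `A (m + 1)`, so all `f n` with `n >
m` vanish and the sum is locally finite. Off `A n` the first `n` terms equal 1, hence `{h < n} ⊆ A
n`. -/
theorem exists_boundsSublevels_of_cover {A : ℕ → Set X} (hA : ⋃ n, A n = univ)
    (hps : ∀ n, IsPseudocompactSpace (A n))
    (hsep : ∀ n, AreCompletelySeparated (A n) (A (n + 1))ᶜ) :
    ∃ h : C(X, ℝ), BoundsSublevels h := by
  choose f hf0 hf1 using hsep
  have hmono : Monotone A := monotone_nat_of_le_succ fun n x hx => by
    by_contra h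
    have := (hf0 n x hx).symm.trans (hf1 n x h)
    exact zero_ne_one this
  have hlf : LocallyFinite fun n => Function.support fun x => (f n x : ℝ) := by
    intro x
    obtain ⟨m, hm⟩ := mem_iUnion.1 (hA.symm ▸ mem_univ x : x ∈ ⋃ n, A n)
    refine ⟨{y | (f m y : ℝ) < 1}, ?_, ?_⟩
    · refine (isOpen_lt (continuous_subtype_val.comp (f m).continuous)
        continuous_const).mem_nhds ?_
      simp [hf0 m x hm]
    · refine (finite_le_nat m).subset ?_
      rintro n ⟨y, hy, hym⟩
      rw [mem_ofPred_eq]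
      by_contra! hn
      have hyA : y ∈ A (m + 1) := by
        by_contra h
        simp [hf1 m y h] at hym
      exact hy (by simp [hf0 n y (hmono hn hyA)])
  let h : C(X, ℝ) := ⟨fun x => ∑ᶠ n, (f n x : ℝ), continuous_finsum
    (fun n => continuous_subtype_val.comp (f n).continuous) hlf⟩
  have hle : ∀ n x, x ∉ A n → n ≤ h x := by
    intro n x hx
    have hfin := hlf.point_finite x
    have h1 : ∀ k < n, f k x = 1 := fun k hk => hf1 k x fun h => hx (hmono hk h)
    have h2 : h x = ∑ k ∈ hfin.toFinset, (f k x : ℝ) :=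
      finsum_eq_sum_of_support_subset _ (by intro k hk; simpa using hk)
    rw [h2]
    calc (n : ℝ) = ∑ k ∈ Finset.range n, (f k x : ℝ) := by
          rw [Finset.sum_congr rfl fun k hk => by rw [h1 k (Finset.mem_range.1 hk)]]
          simp
      _ ≤ _ := Finset.sum_le_sum_of_subset_of_nonneg
          (fun k hk => by simp [h1 k (Finset.mem_range.1 hk)]) fun k _ _ => (f k x).2.1
  refine ⟨h, fun n g => ?_⟩
  obtain ⟨M, hM⟩ := isPseudocompactSpace_iff.1 (hps n) (g.restrict (A n))
  refine ⟨M, fun x hx => ?_⟩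
  by_cases hxA : x ∈ A n
  · exact hM ⟨x, hxA⟩
  · exact absurd (hle n x hxA) (not_le.2 hx)

/-- A continuous real function dominating a given function along a sequence tending
to infinity. -/
theorem exists_continuous_le_of_tendsto {t : ℕ → ℝ} (ht : Tendsto t atTop atTop) (c : ℕ → ℝ) :
    ∃ φ : C(ℝ, ℝ), ∀ k, c k ≤ φ (t k) := by
  -- Since `t` tends to infinity, only finitely many constraints are active near any `s`, so a
  -- constant satisfies them locally; a partition of unity glues.
  obtain ⟨φ, hφ⟩ := exists_continuous_forall_mem_convex_of_local_const
    (t := fun s : ℝ => ⋂ k, {y : ℝ | s = t k → c k ≤ y}) (fun s => convex_iInter fun k => by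
      by_cases h : s = t k
      · simp only [h, forall_const]
        exact convex_Ici (𝕜 := ℝ) (c k)
      · simpa [h] using convex_univ) (fun s => by
      obtain ⟨N, hN⟩ := eventually_atTop.1 (ht.eventually_gt_atTop (s + 1))
      obtain ⟨M, hM⟩ := ((finite_lt_nat N).image c).bddAbove
      refine ⟨M, ?_⟩
      filter_upwards [Iio_mem_nhds (lt_add_one s)] with y hy
      refine mem_iInter.2 fun k hk => hM (mem_image_of_mem c ?_)
      by_contra! hkN
      have := hN k (not_lt.1 hkN)
      rw [← hk] at this
      exact lt_asymm this hy)
  exact ⟨φ, fun k => mem_iInter.1 (hφ (t k)) k rfl⟩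

/-- An unbounded `u` on the closure need not extend to `X`. The product `φ(|u|) * (r - h)` does, by
0, because `r - h` vanishes where the closure meets `{r ≤ h}`. -/
theorem isPseudocompactSpace_closure {h : C(X, ℝ)} {r : ℝ}
    (hb : ∀ f : C(X, ℝ), ∃ M, ∀ x, h x < r → |f x| ≤ M) :
    IsPseudocompactSpace (closure {x | h x < r}) := by
  set S := {x | h x < r}
  rw [isPseudocompactSpace_iff]
  intro u
  by_contra! hu
  have hSr : closure S ⊆ {x | h x ≤ r} := closure_lt_subset_le h.continuous continuous_const
  have hex : ∀ k : ℕ, ∃ x : closure S, x.1 ∈ S ∧ (k : ℝ) < |u x| := by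
    intro k
    obtain ⟨x, hx⟩ := hu k
    have hd : Dense (Subtype.val ⁻¹' S : Set (closure S)) := by
      rw [dense_iff_closure_eq, eq_univ_iff_forall]
      intro y
      rw [closure_subtype, Subtype.image_preimage_coe, inter_eq_right.2 subset_closure]
      exact y.2
    obtain ⟨y, hy, hyS⟩ := hd.inter_open_nonempty _
      (isOpen_lt continuous_const (u.continuous.abs)) ⟨x, hx⟩
    exact ⟨y, hyS, hy⟩
  choose x hxS hxk using hex
  obtain ⟨φ, hφ⟩ := exists_continuous_le_of_tendsto (t := fun k => |u (x k)|)
    (tendsto_atTop_mono (fun k => (hxk k).le) tendsto_natCast_atTop_atTop)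
    -- This growth of `φ` cancels the damping factor, so that `f (x k) ≥ k`.
    fun k => k / (r - h (x k))
  classical
  let f : X → ℝ := fun y => if hy : y ∈ closure S then φ |u ⟨y, hy⟩| * (r - h y) else 0
  have hfc : Continuous f := by
    have hcl1 : IsClosed (closure S) := isClosed_closure
    have hcl2 : IsClosed {y | r ≤ h y} := isClosed_le continuous_const h.continuous
    have hun : closure S ∪ {y | r ≤ h y} = univ := by
      refine eq_univ_of_forall fun y => ?_
      rcases lt_or_ge (h y) r with hy | hy
      · exact Or.inl (subset_closure hy)
      · exact Or.inr hy
    rw [← continuousOn_univ, ← hun]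
    refine ContinuousOn.union_of_isClosed ?_ ?_ hcl1 hcl2
    · rw [continuousOn_iff_continuous_domRestrict]
      have : (closure S).domRestrict f = fun y => φ |u y| * (r - h y) := by
        funext y
        simp [f]
      rw [this]
      fun_prop
    · refine continuousOn_const (c := (0 : ℝ)) |>.congr fun y hy => ?_
      by_cases hyS : y ∈ closure S
      · have : h y = r := le_antisymm (hSr hyS) hy
        simp [f, this]
      · simp [f, hyS]
  obtain ⟨M, hM⟩ := hb ⟨f, hfc⟩
  obtain ⟨k, hk⟩ := exists_nat_gt M
  have h1 : |f (x k)| ≤ M := hM _ (hxS k)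
  have h2 : f (x k) = φ |u (x k)| * (r - h (x k)) := by simp [f]
  have h3 : 0 < r - h (x k) := sub_pos.2 (hxS k)
  have h4 := (div_le_iff₀ h3).1 (hφ k)
  rw [← h2] at h4
  linarith [le_abs_self (f (x k))]

theorem BoundsSublevels.exists_cover {h : C(X, ℝ)} (hh : BoundsSublevels h) :
    ∃ A : ℕ → Set X, (⋃ n, A n) = univ ∧ ∀ n, IsPseudocompactSpace (A n) ∧
      AreCompletelySeparated (A n) (A (n + 1))ᶜ := by
  refine ⟨fun n => closure {x | h x < n}, ?_, fun n =>
    ⟨isPseudocompactSpace_closure (hh n), ?_⟩⟩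
  · refine eq_univ_of_forall fun x => ?_
    obtain ⟨n, hn⟩ := exists_nat_gt (h x)
    exact mem_iUnion.2 ⟨n, subset_closure hn⟩
  · refine ⟨⟨fun x => projIcc 0 1 zero_le_one (h x - n),
      continuous_projIcc.comp (h.continuous.sub continuous_const)⟩, fun x hx => ?_,
      fun x hx => ?_⟩
    · have : h x ≤ n := closure_lt_subset_le h.continuous continuous_const hx
      exact projIcc_of_le_left zero_le_one (by linarith)
    · have : ¬ h x < (n + 1 : ℕ) := fun h' => hx (subset_closure h')
      push_cast at this
      exact projIcc_of_right_le zero_le_one (by linarith)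

end Proper

/-! ### Local compactness and σ-compactness of `υX` -/

section Hewitt

variable {X : Type u} [TopologicalSpace X]

/-- The canonical map of `X` into its Hewitt realcompactification. -/
def toHewitt (X : Type u) [TopologicalSpace X] (x : X) : HewittRealcompactification X :=
  ⟨fun f => f x, subset_closure (mem_range_self x)⟩

theorem continuous_toHewitt : Continuous (toHewitt X) :=
  (continuous_pi fun f => f.continuous).subtype_mk _

/-- The image of `{h < n}` lies in a product of bounded intervals, so its closure is compact; that
closure contains every point of `υX` whose `h`-coordinate is below `n`. -/
theorem BoundsSublevels.exists_compact_nhds {h : C(X, ℝ)} (hh : BoundsSublevels h) :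
    ∃ K : ℕ → Set (HewittRealcompactification X), (∀ n, IsCompact (K n)) ∧
      ∀ p, ∃ n, K n ∈ 𝓝 p := by
  let e : X → C(X, ℝ) → ℝ := fun x f => f x
  let C : ℕ → Set (C(X, ℝ) → ℝ) := fun n => closure (e '' {x | h x < n})
  have hC : ∀ n, IsCompact (C n) := by
    intro n
    choose M hM using hh n
    refine (isCompact_univ_pi fun f => isCompact_Icc (a := -M f) (b := M f)).of_isClosed_subset
      isClosed_closure (closure_minimal ?_ (isClosed_set_pi fun f _ => isClosed_Icc))
    rintro _ ⟨x, hx, rfl⟩ f -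
    exact abs_le.1 (hM f x hx)
  refine ⟨fun n => Subtype.val ⁻¹' C n, fun n =>
    isClosed_closure.isClosedEmbedding_subtypeVal.isCompact_preimage (hC n), fun p => ?_⟩
  obtain ⟨n, hn⟩ := exists_nat_gt (p.1 h)
  have ho : IsOpen {q : C(X, ℝ) → ℝ | q h < n} := isOpen_lt (continuous_apply h) continuous_const
  refine ⟨n, mem_of_superset ((ho.preimage continuous_subtype_val).mem_nhds hn) fun q hq => ?_⟩
  refine closure_mono ?_ (ho.inter_closure ⟨hq, q.2⟩)
  rintro _ ⟨hx, x, rfl⟩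
  exact mem_image_of_mem e hx

theorem BoundsSublevels.locallyCompact_sigmaCompact {h : C(X, ℝ)} (hh : BoundsSublevels h) :
    LocallyCompactSpace (HewittRealcompactification X) ∧
      SigmaCompactSpace (HewittRealcompactification X) := by
  obtain ⟨K, hK, hp⟩ := hh.exists_compact_nhds
  have : WeaklyLocallyCompactSpace (HewittRealcompactification X) :=
    ⟨fun p => (hp p).imp' K fun n hn => ⟨hK n, hn⟩⟩
  refine ⟨inferInstance, ⟨⟨K, hK, eq_univ_of_forall fun p => ?_⟩⟩⟩
  obtain ⟨n, hn⟩ := hp p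
  exact mem_iUnion.2 ⟨n, mem_of_mem_nhds hn⟩

theorem exists_continuous_find_le (Y : Type*) [TopologicalSpace Y] [T2Space Y]
    [LocallyCompactSpace Y] [SigmaCompactSpace Y] (K : CompactExhaustion Y) :
    ∃ H : C(Y, ℝ), ∀ y, K.find y ≤ H y := by
  refine exists_continuous_forall_mem_convex_of_local_const
    (t := fun y => Ici (K.find y : ℝ)) (fun y => convex_Ici _) fun y => ?_
  obtain ⟨n, hn⟩ := K.exists_mem_nhds y
  refine ⟨n, mem_of_superset hn fun z hz => ?_⟩
  exact Nat.cast_le (α := ℝ).2 (K.mem_iff_find_le.1 hz)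

/-- Each `f` extends to `υX` as a coordinate, hence is bounded on compact sets; a function
dominating the exhaustion index has its sublevel sets inside them. -/
theorem exists_boundsSublevels_of_hewitt [LocallyCompactSpace (HewittRealcompactification X)]
    [SigmaCompactSpace (HewittRealcompactification X)] : ∃ h : C(X, ℝ), BoundsSublevels h := by
  let K := CompactExhaustion.choice (HewittRealcompactification X)
  obtain ⟨H, hH⟩ := exists_continuous_find_le _ K
  refine ⟨H.comp ⟨_, continuous_toHewitt⟩, fun n f => ?_⟩
  obtain ⟨M, hM⟩ := (K.isCompact n).exists_bound_of_continuousOn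
    (f := fun p : HewittRealcompactification X => p.1 f)
    ((continuous_apply f).comp continuous_subtype_val).continuousOn
  refine ⟨M, fun x hx => hM (toHewitt X x) (K.mem_iff_find_le.2 ?_)⟩
  exact_mod_cast (hH _).trans hx.le

theorem hewitt_iff_exists_boundsSublevels :
    (LocallyCompactSpace (HewittRealcompactification X) ∧
      SigmaCompactSpace (HewittRealcompactification X)) ↔ ∃ h : C(X, ℝ), BoundsSublevels h :=
  ⟨fun ⟨_, _⟩ => exists_boundsSublevels_of_hewitt,
    fun ⟨_, hh⟩ => hh.locallyCompact_sigmaCompact⟩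

theorem cover_iff_exists_boundsSublevels :
    (∃ A : ℕ → Set X, (⋃ n, A n) = univ ∧ ∀ n, IsPseudocompactSpace (A n) ∧
      AreCompletelySeparated (A n) (A (n + 1))ᶜ) ↔ ∃ h : C(X, ℝ), BoundsSublevels h :=
  ⟨fun ⟨_, hA, h⟩ => exists_boundsSublevels_of_cover hA (fun n => (h n).1) fun n => (h n).2,
    fun ⟨_, hh⟩ => hh.exists_cover⟩

end Hewitt

/-! ### Maximal, minimal and least elements -/

section Order

variable {X : Type u} [TopologicalSpace X]

/-- Along a sequence whose `g`-values increase by more than 1, damp `g` by the distance to the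
odd-indexed values: `h` agrees with `g` at even terms and is 0 at odd ones, while `h ≤ max g 0`. -/
theorem exists_strictly_finer (g : C(X, ℝ)) (hg : (comap g atTop).NeBot) :
    ∃ h : C(X, ℝ), (comap h atTop).NeBot ∧ comap h atTop ≤ comap g atTop ∧
      ¬ comap g atTop ≤ comap h atTop := by
  rw [comap_atTop_neBot_iff] at hg
  choose s hs using hg
  let x : ℕ → X := fun n => Nat.rec (s 0) (fun _ y => s (g y + 1)) n
  have hstep : ∀ n, g (x n) + 1 < g (x (n + 1)) := fun n => hs _
  have hgap : ∀ m n, m < n → g (x m) + 1 < g (x n) := by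
    intro m n hmn
    induction n, hmn using Nat.le_induction with
    | base => exact hstep m
    | succ n _ ih => linarith [hstep n]
  have hlarge : ∀ n : ℕ, (n : ℝ) < g (x n) := by
    intro n
    induction n with
    | zero => exact Nat.cast_zero (R := ℝ).symm ▸ hs 0
    | succ n ih => push_cast; linarith [hstep n]
  let D : Set ℝ := range fun n => g (x (2 * n + 1))
  have hD : D.Nonempty := range_nonempty _
  let h : C(X, ℝ) := ⟨fun y => max (g y) 0 * min 1 (Metric.infDist (g y) D),
    (g.continuous.max continuous_const).mul
      (continuous_const.min ((Metric.continuous_infDist_pt D).comp g.continuous))⟩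
  have hh : ∀ y, h y = max (g y) 0 * min 1 (Metric.infDist (g y) D) := fun y => rfl
  have heven : ∀ n, h (x (2 * n)) = g (x (2 * n)) := by
    intro n
    have h1 : 1 ≤ Metric.infDist (g (x (2 * n))) D := by
      rw [Metric.le_infDist hD]
      rintro _ ⟨m, rfl⟩
      rw [Real.dist_eq, le_abs]
      rcases lt_or_gt_of_ne (show 2 * n ≠ 2 * m + 1 by omega) with hlt | hlt
      · right; linarith [hgap _ _ hlt]
      · left; linarith [hgap _ _ hlt]
    rw [hh, min_eq_left h1, mul_one, max_eq_left ((Nat.cast_nonneg _).trans (hlarge _).le)]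
  refine ⟨h, ?_, ?_, ?_⟩
  · rw [comap_atTop_neBot_iff]
    intro M
    obtain ⟨n, hn⟩ := exists_nat_gt M
    refine ⟨x (2 * n), ?_⟩
    rw [heven]
    have := hlarge (2 * n)
    push_cast at this
    linarith [(Nat.cast_nonneg n : (0 : ℝ) ≤ n)]
  · rw [comap_atTop_le_comap_atTop_iff]
    refine fun r => ⟨max r 0, fun y hy => ?_⟩
    have h1 : h y ≤ max (g y) 0 := by
      rw [hh]
      exact mul_le_of_le_one_right (le_max_right _ _) (min_le_left _ _)
    have h2 := hy.trans_le h1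
    rcases le_total (g y) 0 with h0 | h0
    · rw [max_eq_right h0] at h2
      exact absurd h2 (not_lt.2 (le_max_right _ _))
    · rw [max_eq_left h0] at h2
      exact (le_max_left _ _).trans_lt h2
  · rw [comap_atTop_le_comap_atTop_iff]
    intro hle
    obtain ⟨M, hM⟩ := hle 0
    obtain ⟨n, hn⟩ := exists_nat_gt M
    have h1 := hM (x (2 * n + 1)) (by
      have := hlarge (2 * n + 1)
      push_cast at this
      linarith [(Nat.cast_nonneg n : (0 : ℝ) ≤ n)])
    rw [hh, Metric.infDist_zero_of_mem (show g (x (2 * n + 1)) ∈ D from ⟨n, rfl⟩)] at h1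
    simp at h1

theorem comap_atTop_le_comap_sup (g h : C(X, ℝ)) :
    comap g atTop ≤ comap (g ⊔ h : C(X, ℝ)) atTop :=
  comap_atTop_le_comap_atTop_iff.2 fun r => ⟨r, fun _ hx => hx.trans_le le_sup_left⟩

variable [T2Space X] [LocallyCompactSpace X]

theorem not_exists_maximal_TStar : ¬ ∃ c, Maximal (· ∈ TStar X) c := by
  rintro ⟨c, hc, hmax⟩
  obtain ⟨g, hg, hgt⟩ := exists_hasTrace_of_mem_TStar hc
  obtain ⟨h, hh, hle, hnle⟩ := exists_strictly_finer g hg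
  obtain ⟨d, hd, hdt⟩ := exists_hasTrace_comap_atTop h hh
  exact hnle ((hgt.le_iff hdt).1 (hmax hd ((hdt.le_iff hgt).2 hle)))

theorem exists_minimal_TStar_iff :
    (∃ c, Minimal (· ∈ TStar X) c) ↔ ∃ c, IsLeast (TStar X) c := by
  refine ⟨?_, fun ⟨c, hc⟩ => ⟨c, hc.1, fun _ hd _ => hc.2 hd⟩⟩
  rintro ⟨c, hc, hmin⟩
  refine ⟨c, hc, fun d hd => ?_⟩
  obtain ⟨g, hg, hgt⟩ := exists_hasTrace_of_mem_TStar hc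
  obtain ⟨h, -, hht⟩ := exists_hasTrace_of_mem_TStar hd
  have hgk := comap_atTop_le_comap_sup g h
  have hhk := comap_atTop_le_comap_sup h g
  rw [sup_comm] at hhk
  obtain ⟨k, hk, hkt⟩ := exists_hasTrace_comap_atTop (g ⊔ h) (hg.mono hgk)
  exact (hmin hk ((hgt.le_iff hkt).2 hgk)).trans ((hht.le_iff hkt).2 hhk)

theorem exists_isLeast_TStar_iff :
    (∃ c, IsLeast (TStar X) c) ↔ ∃ h : C(X, ℝ), (comap h atTop).NeBot ∧
      ∀ g : C(X, ℝ), (comap g atTop).NeBot → comap g atTop ≤ comap h atTop := by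
  constructor
  · rintro ⟨c, hc, hmin⟩
    obtain ⟨h, hh, hht⟩ := exists_hasTrace_of_mem_TStar hc
    refine ⟨h, hh, fun g hg => ?_⟩
    obtain ⟨d, hd, hdt⟩ := exists_hasTrace_comap_atTop g hg
    exact (hdt.le_iff hht).1 (hmin hd)
  · rintro ⟨h, hh, hmin⟩
    obtain ⟨c, hc, hct⟩ := exists_hasTrace_comap_atTop h hh
    refine ⟨c, hc, fun d hd => ?_⟩
    obtain ⟨g, hg, hgt⟩ := exists_hasTrace_of_mem_TStar hd
    exact (hgt.le_iff hct).2 (hmin g hg)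

end Order

theorem theorem5p2 (X : Type u) [TopologicalSpace X] [T2Space X] [LocallyCompactSpace X]
    [NoncompactSpace X] :
    (¬ ∃ Y, Maximal (· ∈ TStar X) Y) ∧
    ((∃ Y, Minimal (· ∈ TStar X) Y) ↔ ∃ Y, IsLeast (TStar X) Y) ∧
    ((LocallyCompactSpace (HewittRealcompactification X) ∧
        SigmaCompactSpace (HewittRealcompactification X)) ↔
      ∃ A : ℕ → Set X, (⋃ n, A n) = univ ∧ ∀ n, IsPseudocompactSpace (A n) ∧
        AreCompletelySeparated (A n) (A (n + 1))ᶜ) ∧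
    (¬ IsPseudocompactSpace X → List.TFAE [
      ∃ Y, Minimal (· ∈ TStar X) Y,
      ∃ Y, IsLeast (TStar X) Y,
      LocallyCompactSpace (HewittRealcompactification X) ∧
        SigmaCompactSpace (HewittRealcompactification X),
      ∃ A : ℕ → Set X, (⋃ n, A n) = univ ∧ ∀ n, IsPseudocompactSpace (A n) ∧
        AreCompletelySeparated (A n) (A (n + 1))ᶜ]) := by
  refine ⟨not_exists_maximal_TStar, exists_minimal_TStar_iff,
    hewitt_iff_exists_boundsSublevels.trans cover_iff_exists_boundsSublevels.symm, fun hX => ?_⟩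
  tfae_have 1 ↔ 2 := exists_minimal_TStar_iff
  tfae_have 2 ↔ 3 := exists_isLeast_TStar_iff.trans
    ((exists_boundsSublevels_iff_exists_least hX).symm.trans
      hewitt_iff_exists_boundsSublevels.symm)
  tfae_have 3 ↔ 4 :=
    hewitt_iff_exists_boundsSublevels.trans cover_iff_exists_boundsSublevels.symm
  tfae_finish
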